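/- A Steiner triple system (STS) consists of a finite set $V$ of points and a family $\mathcal{F}$ of $3$-element subsets of $V$, called triples, such that any two distinct points of $V$ lie in exactly one triple. For $A\subseteq V$, let $N(A)$ be the set of all $z\in V\setminus A$ such that $\{x,y,z\}\in\mathcal{F}$ for some distinct $x,y\in A$. The closure $\mathrm{cl}(A)$ is the smallest set $W\supseteq A$ with $N(W)=\emptyset$. The set $A$ is called spreading if $\mathrm{cl}(A)=V$, and a spreading set is called minimal if none of its proper subsets is spreading. Theorem. For every integer $n>3$ there exists a Steiner triple system which has both a minimal spreading set of size $3$ and a minimal spreading set of size $n$. -/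

import Mathlib

namespace STS

/-- A family `F` of finite subsets of `V` is a Steiner triple system on the point set `V`: each
block has three points, and each pair of distinct points lies in exactly one block. -/
def IsSteinerTripleSystem {V : Type*} (F : Set (Finset V)) : Prop :=
  (∀ t ∈ F, t.card = 3) ∧
    ∀ x y : V, x ≠ y → ∃! t : Finset V, t ∈ F ∧ x ∈ t ∧ y ∈ t

/-- The set `N(A)` of neighbours of `A`: the points outside `A` that form a triple of `F` with
two distinct points of `A`. -/
def neighbours {V : Type*} [DecidableEq V] (F : Set (Finset V)) (A : Set V) : Set V :=
  {z | z ∉ A ∧ ∃ x ∈ A, ∃ y ∈ A, x ≠ y ∧ ({x, y, z} : Finset V) ∈ F}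

/-- The closure of `A`: the smallest set `W ⊇ A` with `N(W) = ∅`, realised as the intersection
of all such sets; see `isLeast_closure`. -/
def closure {V : Type*} [DecidableEq V] (F : Set (Finset V)) (A : Set V) : Set V :=
  ⋂₀ {W | A ⊆ W ∧ neighbours F W = ∅}

theorem isLeast_closure {V : Type*} [DecidableEq V] (F : Set (Finset V)) (A : Set V) :
    IsLeast {W | A ⊆ W ∧ neighbours F W = ∅} (closure F A) := by
  refine ⟨⟨Set.subset_sInter fun W hW => hW.1, ?_⟩, fun W hW => Set.sInter_subset_of_mem hW⟩
  rw [Set.eq_empty_iff_forall_notMem]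
  rintro z ⟨hz, x, hx, y, hy, hxy, ht⟩
  refine hz (Set.mem_sInter.2 fun W hW => ?_)
  by_contra hzW
  have hmem : z ∈ neighbours F W :=
    ⟨hzW, x, Set.mem_sInter.1 hx W hW, y, Set.mem_sInter.1 hy W hW, hxy, ht⟩
  rw [hW.2] at hmem
  exact hmem

/-- `A` is spreading if its closure is the whole point set. -/
def IsSpreading {V : Type*} [DecidableEq V] (F : Set (Finset V)) (A : Set V) : Prop :=
  closure F A = Set.univ

/-- A spreading set is minimal if none of its proper subsets is spreading. -/
def IsMinimalSpreading {V : Type*} [DecidableEq V] (F : Set (Finset V)) (A : Set V) : Prop :=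
  IsSpreading F A ∧ ∀ B : Set V, B ⊂ A → ¬ IsSpreading F B

end STS

/-! Triples correspond to a Steiner quasigroup, and spreading to generating. A quasigroup of odd
order `N` with three generators is kept, along with a generating family indexed by `Fin n`; the
indices are made irredundant one at a time. Each step multiplies by the double, of order `2 N + 1`.
The orders are coprime, so a set generates the product once its projections generate
(`generates_prod`), and second coordinates can be chosen freely. The double is generated by
infinity, 0 and 1, but not by 0 and 1 alone. Giving infinity to index `i` only makes `i`
irredundant, while earlier irredundancy survives by projecting to the first factor. -/

/-- A Steiner quasigroup: the algebra `x * y = z` encoding the triples `{x, y, z}` of a Steiner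
triple system. -/
structure SteinerQuasigroup (V : Type*) where
  op : V → V → V
  idem : ∀ x, op x x = x
  comm : ∀ x y, op x y = op y x
  cancel : ∀ x y, op x (op x y) = y

namespace SteinerQuasigroup

variable {V W : Type*}

/-- `S` is closed under the operation. -/
def IsClosed (Q : SteinerQuasigroup V) (S : Set V) : Prop :=
  ∀ x ∈ S, ∀ y ∈ S, Q.op x y ∈ S

/-- `A` generates the Steiner quasigroup. -/
def Generates (Q : SteinerQuasigroup V) (A : Set V) : Prop :=
  ∀ S, A ⊆ S → Q.IsClosed S → S = Set.univ

theorem Generates.mono {Q : SteinerQuasigroup V} {A B : Set V} (h : Q.Generates A) (hAB : A ⊆ B) :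
    Q.Generates B :=
  fun S hS hc => h S (hAB.trans hS) hc

theorem cancel_right (Q : SteinerQuasigroup V) (x y : V) : Q.op (Q.op x y) y = x := by
  rw [Q.comm, Q.comm x y, Q.cancel]

theorem op_injective (Q : SteinerQuasigroup V) (x : V) : Function.Injective (Q.op x) :=
  Function.LeftInverse.injective (Q.cancel x)

theorem op_ne_left (Q : SteinerQuasigroup V) {x y : V} (h : x ≠ y) : Q.op x y ≠ x := by
  intro h'
  exact h (Q.op_injective x ((Q.idem x).trans h'.symm))

theorem op_ne_right (Q : SteinerQuasigroup V) {x y : V} (h : x ≠ y) : Q.op x y ≠ y := by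
  rw [Q.comm]
  exact Q.op_ne_left h.symm

theorem isClosed_line (Q : SteinerQuasigroup V) (x y : V) :
    Q.IsClosed {x, y, Q.op x y} := by
  have h1 := Q.idem
  have h2 := Q.cancel x y
  have h3 := Q.cancel_right x y
  have h4 := Q.comm
  rintro a (rfl | rfl | rfl) b (rfl | rfl | rfl) <;> simp_all

theorem not_generates_pair (Q : SteinerQuasigroup V) [Fintype V] (hV : 3 < Fintype.card V)
    (x y : V) : ¬ Q.Generates {x, y} := by
  classical
  intro h
  have h1 := h {x, y, Q.op x y} (by intro z; simp; tauto) (Q.isClosed_line x y)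
  have h2 : (({x, y, Q.op x y} : Finset V) : Set V) = Set.univ := by simpa using h1
  rw [Finset.coe_eq_univ] at h2
  have h3 := Finset.card_le_three (a := x) (b := y) (c := Q.op x y)
  rw [h2, Finset.card_univ] at h3
  omega

section Triples

variable [DecidableEq V]

/-- The triples of the Steiner triple system of a Steiner quasigroup. -/
def triples (Q : SteinerQuasigroup V) : Set (Finset V) :=
  {t | ∃ x y, x ≠ y ∧ t = {x, y, Q.op x y}}

theorem eq_line_of_mem_triples (Q : SteinerQuasigroup V) {t : Finset V} (ht : t ∈ Q.triples)
    {x y : V} (hxy : x ≠ y) (hx : x ∈ t) (hy : y ∈ t) : t = {x, y, Q.op x y} := by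
  obtain ⟨a, b, -, rfl⟩ := ht
  have h2 := Q.cancel a b
  have h3 := Q.cancel_right a b
  have h4 := Q.comm b a
  have h5 := Q.comm (Q.op a b) a
  have h6 := Q.comm b (Q.op a b)
  simp only [Finset.mem_insert, Finset.mem_singleton] at hx hy
  rcases hx with rfl | rfl | rfl <;> rcases hy with rfl | rfl | rfl <;>
    first
    | exact absurd rfl hxy
    | (ext z; grind)

theorem isSteinerTripleSystem_triples (Q : SteinerQuasigroup V) :
    STS.IsSteinerTripleSystem Q.triples := by
  refine ⟨?_, fun x y hxy => ⟨{x, y, Q.op x y}, ⟨⟨x, y, hxy, rfl⟩, by simp, by simp⟩, ?_⟩⟩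
  · rintro t ⟨x, y, hxy, rfl⟩
    exact Finset.card_eq_three.2
      ⟨x, y, _, hxy, (Q.op_ne_left hxy).symm, (Q.op_ne_right hxy).symm, rfl⟩
  · rintro t ⟨ht, hx, hy⟩
    exact Q.eq_line_of_mem_triples ht hxy hx hy

theorem neighbours_eq_empty_iff (Q : SteinerQuasigroup V) (S : Set V) :
    STS.neighbours Q.triples S = ∅ ↔ Q.IsClosed S := by
  rw [Set.eq_empty_iff_forall_notMem]
  constructor
  · intro h x hx y hy
    by_contra hz
    have hxy : x ≠ y := by
      rintro rfl
      exact hz (by rwa [Q.idem])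
    exact h _ ⟨hz, x, hx, y, hy, hxy, x, y, hxy, rfl⟩
  · rintro h z ⟨hz, x, hx, y, hy, hxy, ht⟩
    have h1 := Q.eq_line_of_mem_triples ht hxy (by simp) (by simp)
    have h2 : z ∈ ({x, y, Q.op x y} : Finset V) := h1 ▸ by simp
    simp only [Finset.mem_insert, Finset.mem_singleton] at h2
    rcases h2 with rfl | rfl | rfl
    · exact hz hx
    · exact hz hy
    · exact hz (h _ hx _ hy)

theorem isSpreading_iff (Q : SteinerQuasigroup V) (A : Set V) :
    STS.IsSpreading Q.triples A ↔ Q.Generates A := by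
  unfold STS.IsSpreading STS.closure
  simp only [neighbours_eq_empty_iff, Set.sInter_eq_univ, Set.mem_ofPred_eq, and_imp]
  rfl

theorem isMinimalSpreading_range {ι : Type*} [Fintype ι] (Q : SteinerQuasigroup V) {f : ι → V}
    (hf : Q.Generates (Set.range f)) (hmin : ∀ i, ¬ Q.Generates (f '' {i}ᶜ)) :
    STS.IsMinimalSpreading Q.triples (Set.range f) ∧ (Set.range f).ncard = Fintype.card ι := by
  refine ⟨⟨(Q.isSpreading_iff _).2 hf, fun B hB hBs => ?_⟩, ?_⟩
  · rw [isSpreading_iff] at hBs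
    obtain ⟨hsub, x, ⟨i, rfl⟩, hx⟩ := (Set.ssubset_iff_exists).1 hB
    refine hmin i (hBs.mono fun y hy => ?_)
    obtain ⟨j, rfl⟩ := hsub hy
    exact ⟨j, by rintro rfl; exact hx hy, rfl⟩
  -- A repeated value would make its index redundant.
  · have hinj : Function.Injective f := by
      intro i j hij
      by_contra hne
      refine hmin i (hf.mono ?_)
      rintro _ ⟨l, rfl⟩
      by_cases hl : l = i
      · exact ⟨j, fun h => hne h.symm, by rw [hl, hij]⟩
      · exact ⟨l, hl, rfl⟩
    rw [← Set.image_univ, Set.ncard_image_of_injective _ hinj, Set.ncard_univ,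
      Nat.card_eq_fintype_card]

end Triples

/-! ### Products of coprime orders -/

/-- The direct product of two Steiner quasigroups. -/
def prod (Q : SteinerQuasigroup V) (R : SteinerQuasigroup W) : SteinerQuasigroup (V × W) where
  op x y := (Q.op x.1 y.1, R.op x.2 y.2)
  idem x := by simp [Q.idem, R.idem]
  comm x y := by simp [Q.comm x.1, R.comm x.2]
  cancel x y := by simp [Q.cancel, R.cancel]

theorem Generates.fst {Q : SteinerQuasigroup V} {R : SteinerQuasigroup W} [Nonempty W]
    {A : Set (V × W)} (h : (Q.prod R).Generates A) : Q.Generates (Prod.fst '' A) := by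
  intro S hS hc
  have h1 := h (Prod.fst ⁻¹' S) (Set.image_subset_iff.1 hS) fun x hx y hy => hc _ hx _ hy
  exact (Set.eq_univ_iff_forall).2 fun x =>
    (Set.eq_univ_iff_forall.1 h1 (x, Classical.arbitrary W) :)

theorem Generates.snd {Q : SteinerQuasigroup V} {R : SteinerQuasigroup W} [Nonempty V]
    {A : Set (V × W)} (h : (Q.prod R).Generates A) : R.Generates (Prod.snd '' A) := by
  intro S hS hc
  have h1 := h (Prod.snd ⁻¹' S) (Set.image_subset_iff.1 hS) fun x hx y hy => hc _ hx _ hy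
  exact (Set.eq_univ_iff_forall).2 fun x =>
    (Set.eq_univ_iff_forall.1 h1 (Classical.arbitrary V, x) :)

/-- The fibres over the first factor of a closed set projecting onto that factor have equal
sizes, so the order of the first factor divides the size of the set. -/
theorem card_dvd_of_isClosed_prod [Fintype V] [Fintype W] [DecidableEq V] [DecidableEq W]
    (Q : SteinerQuasigroup V) (R : SteinerQuasigroup W) (S : Finset (V × W))
    (hS : (Q.prod R).IsClosed (S : Set (V × W))) (hsurj : ∀ x, ∃ y, (x, y) ∈ S) :
    Fintype.card V ∣ S.card := by
  have hle : ∀ x x', (S.filter fun p => p.1 = x).card ≤ (S.filter fun p => p.1 = x').card := by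
    intro x x'
    obtain ⟨y, hy⟩ := hsurj (Q.op x x')
    -- Multiplying by a point of the set over `x * x'` carries the fibre over `x` into the fibre
    -- over `x'`.
    refine Finset.card_le_card_of_injOn ((Q.prod R).op (Q.op x x', y)) ?_
      ((Q.prod R).op_injective _).injOn
    intro p hp
    simp only [Finset.coe_filter, Set.mem_ofPred_eq] at hp ⊢
    refine ⟨hS _ hy _ hp.1, ?_⟩
    change Q.op (Q.op x x') p.1 = x'
    rw [hp.2, Q.comm, Q.cancel]
  rcases isEmpty_or_nonempty V with hV | ⟨⟨x₀⟩⟩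
  · simp [Finset.eq_empty_of_isEmpty S]
  · rw [Finset.card_eq_sum_card_fiberwise (f := Prod.fst) (t := Finset.univ) (by simp),
      Finset.sum_congr rfl fun x _ => le_antisymm (hle x x₀) (hle x₀ x)]
    simp

/-- In a product of coprime orders, a set generates if its projections do. -/
theorem generates_prod [Fintype V] [Fintype W] [Nonempty V] [Nonempty W]
    (Q : SteinerQuasigroup V) (R : SteinerQuasigroup W)
    (hco : Nat.Coprime (Fintype.card V) (Fintype.card W)) {A : Set (V × W)}
    (h1 : Q.Generates (Prod.fst '' A)) (h2 : R.Generates (Prod.snd '' A)) :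
    (Q.prod R).Generates A := by
  classical
  intro S hA hS
  have hS1 : Prod.fst '' S = Set.univ := by
    refine h1 _ (Set.image_mono hA) ?_
    rintro _ ⟨p, hp, rfl⟩ _ ⟨q, hq, rfl⟩
    exact ⟨_, hS p hp q hq, rfl⟩
  have hS2 : Prod.snd '' S = Set.univ := by
    refine h2 _ (Set.image_mono hA) ?_
    rintro _ ⟨p, hp, rfl⟩ _ ⟨q, hq, rfl⟩
    exact ⟨_, hS p hp q hq, rfl⟩
  have e1 : ∀ x, ∃ y, (x, y) ∈ S := fun x => by
    obtain ⟨p, hp, rfl⟩ := Set.eq_univ_iff_forall.1 hS1 x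
    exact ⟨p.2, hp⟩
  have e2 : ∀ y, ∃ x, (x, y) ∈ S := fun y => by
    obtain ⟨p, hp, rfl⟩ := Set.eq_univ_iff_forall.1 hS2 y
    exact ⟨p.1, hp⟩
  have d1 := card_dvd_of_isClosed_prod Q R S.toFinset (by simpa using hS) (by simpa using e1)
  have d2 := card_dvd_of_isClosed_prod R Q (S.toFinset.map (Equiv.prodComm V W).toEmbedding)
    (by
      intro p hp q hq
      simp only [Finset.coe_map, Set.coe_toFinset] at hp hq ⊢
      obtain ⟨p, hp, rfl⟩ := hp
      obtain ⟨q, hq, rfl⟩ := hq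
      exact ⟨_, hS p hp q hq, rfl⟩)
    (fun y => by
      obtain ⟨x, hx⟩ := e2 y
      exact ⟨x, Finset.mem_map.2 ⟨(x, y), by simpa using hx, rfl⟩⟩)
  rw [Finset.card_map] at d2
  have hpos : 0 < S.toFinset.card := by
    obtain ⟨y, hy⟩ := e1 (Classical.arbitrary V)
    exact Finset.card_pos.2 ⟨_, Set.mem_toFinset.2 hy⟩
  have hle := Nat.le_of_dvd hpos (hco.mul_dvd_of_dvd_of_dvd d1 d2)
  rw [← Fintype.card_prod] at hle
  have := Finset.eq_univ_of_card _ (le_antisymm (Finset.card_le_univ _) hle)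
  rwa [Set.toFinset_eq_univ] at this

/-! ### The doubling construction -/

section Double

variable {N : ℕ}

/-- The operation of `double`. -/
def doubleOp (Q : SteinerQuasigroup V) (e : ZMod N ≃ V) (h : ZMod N) :
    V ⊕ Option (ZMod N) → V ⊕ Option (ZMod N) → V ⊕ Option (ZMod N)
  | .inl p, .inl q => .inl (Q.op p q)
  | .inl q, .inr none => .inr (some (h * e.symm q))
  | .inr none, .inl q => .inr (some (h * e.symm q))
  | .inl q, .inr (some x) => if e.symm q = x + x then .inr none else .inr (some (e.symm q - x))
  | .inr (some x), .inl q => if e.symm q = x + x then .inr none else .inr (some (e.symm q - x))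
  | .inr none, .inr none => .inr none
  | .inr none, .inr (some x) => .inl (e (x + x))
  | .inr (some x), .inr none => .inl (e (x + x))
  | .inr (some x), .inr (some y) => if x = y then .inr (some x) else .inl (e (x + y))

/-- The doubling construction, of order `2 N + 1`: the points outside `V` are `ZMod N` and a point
at infinity, and the one-factor labelled `s` consists of the pairs in `ZMod N` with sum `s` and
of the pair joining `s / 2` to infinity. -/
def double (Q : SteinerQuasigroup V) (e : ZMod N ≃ V) (h : ZMod N) (hh : h + h = 1) :
    SteinerQuasigroup (V ⊕ Option (ZMod N)) where
  op := Q.doubleOp e h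
  idem := by
    rintro (x | _ | x) <;> simp [doubleOp, Q.idem]
  comm := by
    rintro (x | _ | x) (y | _ | y) <;> try rfl
    · exact congrArg Sum.inl (Q.comm x y)
    simp only [doubleOp]
    by_cases hxy : x = y
    · simp [hxy]
    · simp [hxy, Ne.symm hxy, add_comm]
  cancel := by
    have hs : ∀ a : ZMod N, h * a + h * a = a := fun a => by rw [← add_mul, hh, one_mul]
    have hs' : ∀ a : ZMod N, h * (a + a) = a := fun a => by rw [mul_add, hs]
    rintro (x | _ | x) (y | _ | y)
    · simp [doubleOp, Q.cancel]
    · simp [doubleOp, hs]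
    · by_cases hxy : e.symm x = y + y
      · simp [doubleOp, hxy, hs']
      · have : e.symm x ≠ (e.symm x - y) + (e.symm x - y) := fun h0 => hxy (by
          linear_combination -h0)
        simp only [doubleOp, hxy, if_false]
        rw [if_neg this, sub_sub_cancel]
    · simp [doubleOp, hs]
    · simp [doubleOp]
    · simp [doubleOp, hs']
    · by_cases hxy : e.symm y = x + x
      · simp only [doubleOp, if_pos hxy]
        rw [← hxy, e.apply_symm_apply]
      · have : x ≠ e.symm y - x := fun h0 => hxy (by linear_combination -h0)
        simp only [doubleOp, hxy, if_false]
        rw [if_neg this, add_sub_cancel, e.apply_symm_apply]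
    · simp [doubleOp]
    · by_cases hxy : x = y
      · simp [doubleOp, hxy]
      · have : y ≠ x := Ne.symm hxy
        simp [doubleOp, hxy, this]

/-- Products of the three points give the labels 0, 1, 2, hence all of `V`; multiplying `V` by
infinity gives the rest. -/
theorem generates_double (Q : SteinerQuasigroup V) (e : ZMod N ≃ V) (h : ZMod N) (hh : h + h = 1)
    (h01 : (0 : ZMod N) ≠ 1) (hgen : Q.Generates {e 0, e 1, e (1 + 1)}) :
    (Q.double e h hh).Generates {.inr none, .inr (some 0), .inr (some 1)} := by
  intro S hS hc
  have i0 : .inr none ∈ S := hS (by simp)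
  have i1 : .inr (some 0) ∈ S := hS (by simp)
  have i2 : .inr (some 1) ∈ S := hS (by simp)
  have hl : Sum.inl ⁻¹' S = Set.univ := by
    refine hgen _ ?_ fun x hx y hy => hc _ hx _ hy
    rintro _ (rfl | rfl | rfl)
    · simpa [double, doubleOp] using hc _ i0 _ i1
    · simpa [double, doubleOp, h01] using hc _ i1 _ i2
    · simpa [double, doubleOp] using hc _ i0 _ i2
  have hl' : ∀ q, .inl q ∈ S := fun q => (Set.eq_univ_iff_forall.1 hl q :)
  refine Set.eq_univ_iff_forall.2 ?_
  rintro (q | _ | x)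
  · exact hl' q
  · exact i0
  · have := hc _ i0 _ (hl' (e (x + x)))
    have hx : h * (x + x) = x := by rw [mul_add, ← add_mul, hh, one_mul]
    simpa [double, doubleOp, hx] using this

/-- The third point on the line through 0 and 1 is `e 1`, so this line misses infinity. -/
theorem not_generates_double_pair (Q : SteinerQuasigroup V) (e : ZMod N ≃ V) (h : ZMod N)
    (hh : h + h = 1) (h01 : (0 : ZMod N) ≠ 1) :
    ¬ (Q.double e h hh).Generates {.inr (some 0), .inr (some 1)} := by
  intro hg
  have h1 := hg _ (by intro z; simp; tauto)
    ((Q.double e h hh).isClosed_line (.inr (some 0)) (.inr (some 1)))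
  have h2 := Set.eq_univ_iff_forall.1 h1 (.inr none)
  simp [double, doubleOp, h01] at h2

end Double

/-- The labelling in `double` is arbitrary, so three given generators can receive the labels 0, 1,
2. -/
theorem exists_equiv_of_three [Fintype V] (hV : 3 ≤ Fintype.card V) {g : Fin 3 → V}
    (hg : Function.Injective g) :
    ∃ e : ZMod (Fintype.card V) ≃ V, e 0 = g 0 ∧ e 1 = g 1 ∧ e (1 + 1) = g 2 := by
  set N := Fintype.card V with hN
  have : NeZero N := ⟨by omega⟩
  let k : Fin 3 → ZMod N := fun i => ((i : ℕ) : ZMod N)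
  have hk : Function.Injective k := by
    intro i j hij
    have h1 := congrArg ZMod.val hij
    simp only [k] at h1
    rw [ZMod.val_cast_of_lt (by omega), ZMod.val_cast_of_lt (by omega)] at h1
    exact Fin.ext h1
  let e₀ : ZMod N ≃ V := Fintype.equivOfCardEq (by rw [ZMod.card])
  obtain ⟨σ, hσ⟩ := (Equiv.Perm.isMultiplyPretransitive V 3).exists_smul_eq
    (⟨e₀ ∘ k, e₀.injective.comp hk⟩ : Fin 3 ↪ V) ⟨g, hg⟩
  have hσ' : ∀ i, σ (e₀ (k i)) = g i := fun i => DFunLike.congr_fun hσ i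
  refine ⟨e₀.trans σ, ?_, ?_, ?_⟩
  · simpa [k] using hσ' 0
  · simpa [k] using hσ' 1
  · simpa [k, one_add_one_eq_two] using hσ' 2

/-- The Steiner quasigroup of order three. -/
def line : SteinerQuasigroup (ZMod 3) where
  op x y := -x - y
  idem := by decide
  comm := by decide
  cancel := by decide

theorem generates_line {A : Set (ZMod 3)} (h0 : 0 ∈ A) (h1 : 1 ∈ A) : line.Generates A := by
  intro S hS hc
  have h2 := hc _ (hS h0) _ (hS h1)
  refine Set.eq_univ_iff_forall.2 fun x => ?_
  fin_cases x
  · exact hS h0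
  · exact hS h1
  · exact h2

/-! ### The induction on irredundant indices -/

/-- For each finite set `s` of indices there is a Steiner quasigroup of odd order generated by
three elements, and a generating family in which no index in `s` is redundant. -/
theorem exists_generating_family {ι : Type*} [Fintype ι] [DecidableEq ι] (hι : 3 ≤ Fintype.card ι)
    (s : Finset ι) :
    ∃ (V : Type) (_ : Fintype V) (Q : SteinerQuasigroup V) (g : Fin 3 → V) (f : ι → V),
      Odd (Fintype.card V) ∧ Function.Injective g ∧ Q.Generates (Set.range g) ∧
      Q.Generates (Set.range f) ∧ ∀ i ∈ s, ¬ Q.Generates (f '' {i}ᶜ) := by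
  induction s using Finset.induction_on with
  | empty =>
    obtain ⟨a, b, hab⟩ := Fintype.exists_pair_of_one_lt_card (α := ι) (by omega)
    refine ⟨ZMod 3, inferInstance, line, ![0, 1, 2], fun i => if i = a then 0 else 1,
      by decide, by decide, generates_line ⟨0, rfl⟩ ⟨1, rfl⟩,
      generates_line ⟨a, by simp⟩ ⟨b, by simp [hab.symm]⟩, by simp⟩
  | insert i s _ ih =>
    obtain ⟨V, _, Q, g, f, hodd, hg, hgg, hfg, hmin⟩ := ih
    have hV : 3 ≤ Fintype.card V := by simpa using Fintype.card_le_of_injective g hg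
    have he := exists_equiv_of_three hV hg
    obtain ⟨N, hN⟩ : ∃ N, N = Fintype.card V := ⟨_, rfl⟩
    rw [← hN] at hV hodd he
    obtain ⟨e, he0, he1, he2⟩ := he
    have : NeZero N := ⟨by omega⟩
    have : Fact (1 < N) := ⟨by omega⟩
    have h01 : (0 : ZMod N) ≠ 1 := zero_ne_one
    obtain ⟨m, hm⟩ := hodd
    -- As `N = 2 m + 1`, one half modulo `N` is `m + 1`.
    have hh : ((m + 1 : ℕ) : ZMod N) + ((m + 1 : ℕ) : ZMod N) = 1 := by
      have : ((N : ℕ) : ZMod N) = 0 := ZMod.natCast_self N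
      rw [← Nat.cast_add, show m + 1 + (m + 1) = N + 1 by omega, Nat.cast_add, this]
      simp
    have hcard : Fintype.card (V ⊕ Option (ZMod N)) = 2 * N + 1 := by
      simp [ZMod.card]
      omega
    have hco : Nat.Coprime (Fintype.card V) (Fintype.card (V ⊕ Option (ZMod N))) := by
      rw [hcard, ← hN]
      simp
    have : Nonempty V := ⟨g 0⟩
    obtain ⟨j, hji⟩ : ∃ j, j ≠ i := by
      by_contra! h
      have := Finset.card_le_one.2 fun a (_ : a ∈ Finset.univ) b _ => (h a).trans (h b).symm
      rw [Finset.card_univ] at this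
      omega
    obtain ⟨l, hl⟩ : ∃ l, l ∉ ({i, j} : Finset ι) := by
      by_contra! h
      have := Finset.card_le_two (a := i) (b := j)
      rw [Finset.eq_univ_iff_forall.2 h, Finset.card_univ] at this
      omega
    simp only [Finset.mem_insert, Finset.mem_singleton, not_or] at hl
    set R := Q.double e _ hh
    have hR : R.Generates {.inr none, .inr (some 0), .inr (some 1)} := by
      refine Q.generates_double e _ hh h01 (hgg.mono ?_)
      rintro _ ⟨a, rfl⟩
      fin_cases a <;> simp [he0, he1, he2]
    -- Only `i` is sent to infinity; `j` and `l` ensure that 0 and 1 occur.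
    let k : ι → V ⊕ Option (ZMod N) := fun a =>
      if a = i then .inr none else if a = j then .inr (some 0) else .inr (some 1)
    have : Nonempty (V ⊕ Option (ZMod N)) := ⟨.inr none⟩
    refine ⟨V × (V ⊕ Option (ZMod N)), inferInstance, Q.prod R,
      fun a => (g a, ![.inr none, .inr (some 0), .inr (some 1)] a), fun a => (f a, k a),
      ?_, fun a b hab => hg (congrArg Prod.fst hab), ?_, ?_, ?_⟩
    · rw [Fintype.card_prod, hcard, ← hN, Nat.odd_mul]
      exact ⟨⟨m, hm⟩, ⟨N, rfl⟩⟩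
    · refine Q.generates_prod R hco ?_ ?_
      · rw [← Set.range_comp]
        exact hgg
      · rw [← Set.range_comp]
        refine hR.mono ?_
        rintro _ (rfl | rfl | rfl)
        exacts [⟨0, rfl⟩, ⟨1, rfl⟩, ⟨2, rfl⟩]
    · refine Q.generates_prod R hco ?_ ?_
      · rw [← Set.range_comp]
        exact hfg
      · rw [← Set.range_comp]
        refine hR.mono ?_
        rintro _ (rfl | rfl | rfl)
        exacts [⟨i, by simp [k]⟩, ⟨j, by simp [k, hji]⟩, ⟨l, by simp [k, hl]⟩]
    · intro a ha hgen
      rcases Finset.mem_insert.1 ha with rfl | ha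
      · refine Q.not_generates_double_pair e _ hh h01 (hgen.snd.mono ?_)
        rintro _ ⟨_, ⟨b, hb, rfl⟩, rfl⟩
        have hb' : b ≠ a := hb
        by_cases hbj : b = j <;> simp [k, hb', hbj, hji]
      · refine hmin a ha ?_
        have := hgen.fst
        rwa [Set.image_image] at this

end SteinerQuasigroup

theorem theorem4 (n : ℕ) (hn : 3 < n) :
    ∃ (V : Type) (_ : Fintype V) (_ : DecidableEq V) (F : Set (Finset V)),
      STS.IsSteinerTripleSystem F ∧
      (∃ B : Set V, STS.IsMinimalSpreading F B ∧ B.ncard = 3) ∧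
      (∃ A : Set V, STS.IsMinimalSpreading F A ∧ A.ncard = n) := by
  classical
  obtain ⟨V, _, Q, g, f, -, -, hgg, hfg, hmin⟩ :=
    SteinerQuasigroup.exists_generating_family (ι := Fin n) (by simp; omega) Finset.univ
  have hA := Q.isMinimalSpreading_range hfg fun i => hmin i (Finset.mem_univ i)
  rw [Fintype.card_fin] at hA
  have hV : 3 < Fintype.card V := by
    have h1 := Set.ncard_le_ncard (Set.subset_univ (Set.range f))
    rw [hA.2, Set.ncard_univ, Nat.card_eq_fintype_card] at h1
    omega
  have hB := Q.isMinimalSpreading_range hgg fun i hi => ?_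
  · rw [Fintype.card_fin] at hB
    exact ⟨V, inferInstance, inferInstance, Q.triples, Q.isSteinerTripleSystem_triples,
      ⟨_, hB⟩, _, hA⟩
  -- In `Fin 3`, the indices other than `i` are `i + 1` and `i + 2`.
  refine Q.not_generates_pair hV (g (i + 1)) (g (i + 2)) (hi.mono ?_)
  rintro _ ⟨j, hj, rfl⟩
  have : j = i + 1 ∨ j = i + 2 := by
    have hj' : j ≠ i := hj
    clear hj hi
    decide +revert
  rcases this with rfl | rfl <;> simp
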